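/- Let $K$ be a field of characteristic $0$, let $c_2,c_3\in K$, and let $\mu(t)=t^2+c_2t+c_3$ be a quadratic lattice. On polynomials in $\mu(t)$ define $$\mathbb D f(t)=\frac{f(t+\frac12)-f(t-\frac12)}{\mu(t+\frac12)-\mu(t-\frac12)},\qquad \mathbb S f(t)=\frac{f(t+\frac12)+f(t-\frac12)}2 .$$ Let $\vartheta_n(t)=(-4)^{-n}(2t+\frac12+c_2)_n(-2t+\frac12-c_2)_n$, where $(a)_n$ is the Pochhammer symbol, and put $f_n=-\frac{c_2^2}4+\frac{(2n+1)^2}{16}+c_3$ and $g_n=\frac{n(2n-1)}4$. Define infinite matrices indexed by $n,k\ge 0$, all of whose entries not listed are $0$: $D_{n,n-1}=n$; $G_{n,n}=1$, $G_{n,n-1}=g_n$; $\mathbf X^1_{n,n+1}=1$, $\mathbf X^1_{n,n}=f_n$. A sequence $\{P_n\}_{n\ge0}$ of polynomials over $K$, with $P_n$ monic of degree $n$, is a monic orthogonal polynomial sequence (OPS) if there is a linear functional $u$ on polynomials with $u(P_mP_n)=0$ for $m\ne n$ and $u(P_n^2)\neq0$ for all $n$. It is a classical OPS on the lattice $\mu$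 if it is a monic OPS and $\{\frac1{n+1}\mathbb D P_{n+1}\}_{n\ge0}$ is a monic OPS as well. Let $\{P_n\}_{n\ge0}$ be any sequence with $P_n$ monic of degree $n$, and let $A$ be the lower triangular matrix of its coefficients, $P_n(\mu(t))=\sum_{k\le n}A_{n,k}\vartheta_k(t)$. For $\phi(x)=a_0x^2+a_1x+a_2$ and $\psi(x)=b_0x+b_1$ over $K$ put $\lambda_n=n((n-1)a_0+b_0)$ and $\Lambda=\mathrm{diag}(\lambda_0,\lambda_1,\dots)$, and consider the Sylvester equation $$A\big(D^2\phi(\mathbf X^1)+DG\,\psi(\mathbf X^1)\big)=\Lambda A .\qquad(*)$$ Then: 1. For all $\phi,\psi$ as above, $(*)$ holds if and only if $\phi\,\mathbb D^2P_n+\psi\,\mathbb S\mathbb D P_n=\lambda_nP_n$ for every $n\ge0$. 2. $\{P_n\}$ is a classical OPS on the lattice $\mu$ if and only if it is a monic OPS and there are $\phi,\psi$ as above such that the $\lambda_n$ are pairwise distinct and $(*)$ holds. 3. If $(*)$ holds for some $\phi,\psi$ as above with pairwise distinct $\lambda_n$, then there are $\beta_n$ $(n\ge0)$ and $\gamma_n$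 $(n\ge1)$ in $K$ with $P_1=x-\beta_0$ and $xP_n=P_{n+1}+\beta_nP_n+\gamma_nP_{n-1}$ for all $n\ge1$, and $\{P_n\}$ is a classical OPS on the lattice $\mu$ if and only if $\gamma_n\ne0$ for all $n\ge1$. -/

import Mathlib

open Polynomial

namespace QuadLattice

variable {K : Type*} [Field K] [CharZero K]

/-- The quadratic lattice `μ(t) = t² + c₂ t + c₃`. -/
def mu (c₂ c₃ t : K) : K := t ^ 2 + c₂ * t + c₃

/-- For every polynomial `p`, the functions `t ↦ (p(μ(t+1/2)) - p(μ(t-1/2))) / (μ(t+1/2) - μ(t-1/2))`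
and `t ↦ (p(μ(t+1/2)) + p(μ(t-1/2))) / 2` are polynomials in `μ(t)`. -/
theorem exists_divDiff_mean (c₂ c₃ : K) (p : K[X]) :
    ∃ q r : K[X],
      (∀ t : K, (mu c₂ c₃ (t + 1 / 2) - mu c₂ c₃ (t - 1 / 2)) * q.eval (mu c₂ c₃ t) =
        p.eval (mu c₂ c₃ (t + 1 / 2)) - p.eval (mu c₂ c₃ (t - 1 / 2))) ∧
      (∀ t : K, r.eval (mu c₂ c₃ t) =
        (p.eval (mu c₂ c₃ (t + 1 / 2)) + p.eval (mu c₂ c₃ (t - 1 / 2))) / 2) := by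
  have h2 : (2 : K) ≠ 0 := two_ne_zero
  induction p using Polynomial.induction_on with
  | C a => exact ⟨0, C a, fun t => by simp, fun t => by simp⟩
  | add p₁ p₂ h₁ h₂ =>
    obtain ⟨q₁, r₁, hq₁, hr₁⟩ := h₁
    obtain ⟨q₂, r₂, hq₂, hr₂⟩ := h₂
    refine ⟨q₁ + q₂, r₁ + r₂, fun t => ?_, fun t => ?_⟩
    · simp only [eval_add, mul_add, hq₁, hq₂]; ring
    · simp only [eval_add, hr₁, hr₂]; ring
  | monomial n a h =>
    obtain ⟨q, r, hq, hr⟩ := h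
    refine ⟨r + (X + C (1 / 4)) * q, (X + C (1 / 4)) * r + (X + C (c₂ ^ 2 / 4 - c₃)) * q,
      fun t => ?_, fun t => ?_⟩
    · have e : (C a * X ^ (n + 1) : K[X]) = (C a * X ^ n) * X := by ring
      have h4 : (1 / 4 : K) = (1 / 2) ^ 2 := by norm_num
      have hqt := hq t
      have hrt := hr t
      rw [e]
      simp only [eval_add, eval_mul, eval_X, eval_C] at hqt hrt ⊢
      rw [hrt, mul_add, mul_left_comm, hqt]
      simp only [mu]
      ring
    · have e : (C a * X ^ (n + 1) : K[X]) = (C a * X ^ n) * X := by ring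
      have hqt := hq t
      have hrt := hr t
      rw [e]
      simp only [eval_add, eval_mul, eval_X, eval_C] at hqt hrt ⊢
      rw [hrt]
      have key : (mu c₂ c₃ t + (c₂ ^ 2 / 4 - c₃)) =
          (2 * t + c₂) / 4 * (mu c₂ c₃ (t + 1 / 2) - mu c₂ c₃ (t - 1 / 2)) := by
        simp only [mu]; ring
      rw [key, mul_assoc, hqt]
      simp only [mu]
      ring

/-- The divided-difference operator `𝔻` on polynomials in the lattice: `divDiff c₂ c₃ p` is the
polynomial `q` with `q(μ(t)) = (p(μ(t+1/2)) - p(μ(t-1/2))) / (μ(t+1/2) - μ(t-1/2))`. -/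
noncomputable def divDiff (c₂ c₃ : K) (p : K[X]) : K[X] :=
  (exists_divDiff_mean c₂ c₃ p).choose

/-- The averaging operator `𝕊` on polynomials in the lattice: `mean c₂ c₃ p` is the polynomial `r`
with `r(μ(t)) = (p(μ(t+1/2)) + p(μ(t-1/2))) / 2`. -/
noncomputable def mean (c₂ c₃ : K) (p : K[X]) : K[X] :=
  (exists_divDiff_mean c₂ c₃ p).choose_spec.choose

theorem divDiff_spec (c₂ c₃ : K) (p : K[X]) (t : K) :
    (mu c₂ c₃ (t + 1 / 2) - mu c₂ c₃ (t - 1 / 2)) * (divDiff c₂ c₃ p).eval (mu c₂ c₃ t) =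
      p.eval (mu c₂ c₃ (t + 1 / 2)) - p.eval (mu c₂ c₃ (t - 1 / 2)) :=
  (exists_divDiff_mean c₂ c₃ p).choose_spec.choose_spec.1 t

theorem divDiff_eval (c₂ c₃ : K) (p : K[X]) (t : K)
    (ht : mu c₂ c₃ (t + 1 / 2) - mu c₂ c₃ (t - 1 / 2) ≠ 0) :
    (divDiff c₂ c₃ p).eval (mu c₂ c₃ t) =
      (p.eval (mu c₂ c₃ (t + 1 / 2)) - p.eval (mu c₂ c₃ (t - 1 / 2))) /
        (mu c₂ c₃ (t + 1 / 2) - mu c₂ c₃ (t - 1 / 2)) := by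
  rw [eq_div_iff ht, mul_comm, divDiff_spec]

theorem mean_eval (c₂ c₃ : K) (p : K[X]) (t : K) :
    (mean c₂ c₃ p).eval (mu c₂ c₃ t) =
      (p.eval (mu c₂ c₃ (t + 1 / 2)) + p.eval (mu c₂ c₃ (t - 1 / 2))) / 2 :=
  (exists_divDiff_mean c₂ c₃ p).choose_spec.choose_spec.2 t

/-- A polynomial in the lattice is determined by its values off the zero of
`μ(t+1/2) - μ(t-1/2)`; hence the two defining properties above determine `divDiff` and `mean`. -/
theorem eq_of_eval_mu (c₂ c₃ : K) (p q : K[X])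
    (h : ∀ t : K, mu c₂ c₃ (t + 1 / 2) - mu c₂ c₃ (t - 1 / 2) ≠ 0 →
      p.eval (mu c₂ c₃ t) = q.eval (mu c₂ c₃ t)) : p = q := by
  set m : K[X] := X ^ 2 + C c₂ * X + C c₃ with hm
  have hmd : m.natDegree = 2 := by rw [hm]; compute_degree!
  have hl : (C 2 * X + C c₂ : K[X]) ≠ 0 := by
    intro h0
    have := congrArg (fun s : K[X] => s.coeff 1) h0
    simp at this
  have hz : (C 2 * X + C c₂) * (p - q).comp m = 0 := by
    refine Polynomial.funext fun t => ?_
    have e : mu c₂ c₃ (t + 1 / 2) - mu c₂ c₃ (t - 1 / 2) = 2 * t + c₂ := by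
      simp only [mu]; ring
    have hme : m.eval t = mu c₂ c₃ t := by simp [hm, mu]
    by_cases ht : 2 * t + c₂ = 0
    · simp [ht]
    · have := h t (by rwa [e])
      simp [eval_comp, hme, this]
  rcases mul_eq_zero.1 hz with h0 | h0
  · exact absurd h0 hl
  · rcases Polynomial.comp_eq_zero_iff.1 h0 with h1 | ⟨-, h1⟩
    · exact sub_eq_zero.1 h1
    · rw [h1] at hmd
      simp at hmd

/-- The basis `ϑ_n(t) = (-4)^{-n} (2t + 1/2 + c₂)_n (-2t + 1/2 - c₂)_n`, with `(a)_n` the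
Pochhammer symbol. -/
noncomputable def theta (c₂ : K) (n : ℕ) (t : K) : K :=
  ((-4 : K) ^ n)⁻¹ * (ascPochhammer K n).eval (2 * t + 1 / 2 + c₂) *
    (ascPochhammer K n).eval (-2 * t + 1 / 2 - c₂)

/-- `P` is a sequence of monic polynomials with `P n` of degree `n`. -/
def IsMonicSeq (P : ℕ → K[X]) : Prop :=
  ∀ n, (P n).Monic ∧ (P n).natDegree = n

/-- `P` is a monic orthogonal polynomial sequence (monic OPS): `P n` is monic of degree `n` and
there is a linear functional `u` on polynomials with `u(P_m P_n) = 0` for `m ≠ n` and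
`u(P_n ^ 2) ≠ 0` for all `n`. -/
def IsOPS (P : ℕ → K[X]) : Prop :=
  IsMonicSeq P ∧ ∃ u : K[X] →ₗ[K] K,
    (∀ m n, m ≠ n → u (P m * P n) = 0) ∧ ∀ n, u (P n * P n) ≠ 0

/-- The monic sequence of divided differences: its `n`-th term is `(1/(n+1)) 𝔻 P_{n+1}`. -/
noncomputable def derivedSeq (c₂ c₃ : K) (P : ℕ → K[X]) (n : ℕ) : K[X] :=
  C (1 / ((n : K) + 1)) * divDiff c₂ c₃ (P (n + 1))

/-- `P` is a classical OPS on the lattice: `P` is a monic OPS whose sequence of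
(normalized) divided differences is again a monic OPS. -/
def IsClassicalOPS (c₂ c₃ : K) (P : ℕ → K[X]) : Prop :=
  IsOPS P ∧ IsOPS (derivedSeq c₂ c₃ P)

/-- `A` is the lower triangular matrix of the coefficients of the `P_n` in the basis `ϑ`:
`P_n(μ(t)) = ∑_{k ≤ n} A_{n,k} ϑ_k(t)`. -/
def IsCoeffMatrix (c₂ c₃ : K) (P : ℕ → K[X]) (A : Matrix ℕ ℕ K) : Prop :=
  (∀ n k, n < k → A n k = 0) ∧
    ∀ n t, (P n).eval (mu c₂ c₃ t) = ∑ k ∈ Finset.range (n + 1), A n k * theta c₂ k t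

/-- Product of infinite matrices. The entries are finite sums as soon as the rows of `M`
have finite support, which is the case for all products formed below. -/
noncomputable def infMul (M N : Matrix ℕ ℕ K) : Matrix ℕ ℕ K :=
  fun i j => ∑ᶠ k, M i k * N k j

/-- The matrix `D`, with entries `1, 2, 3, …` just below the diagonal. -/
def matD (K : Type*) [Field K] : Matrix ℕ ℕ K :=
  fun i j => if i = j + 1 then (i : K) else 0

/-- `g_n = n (2n - 1) / 4`. -/
def gCoeff (K : Type*) [Field K] (n : ℕ) : K := (n : K) * (2 * (n : K) - 1) / 4

/-- The matrix `G`, with `1` on the diagonal and `g_1, g_2, …` just below it. -/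
def matG (K : Type*) [Field K] : Matrix ℕ ℕ K :=
  fun i j => if i = j then 1 else if i = j + 1 then gCoeff K i else 0

/-- `f_n = -c₂²/4 + (2n+1)²/16 + c₃`. -/
def fCoeff (c₂ c₃ : K) (n : ℕ) : K := -c₂ ^ 2 / 4 + 1 / 16 * (2 * (n : K) + 1) ^ 2 + c₃

/-- The matrix `𝐗¹ = X + diag(f_0, f_1, …)`, where `X` has `1` just above the diagonal. -/
def matX1 (c₂ c₃ : K) : Matrix ℕ ℕ K :=
  fun i j => if j = i + 1 then 1 else if i = j then fCoeff c₂ c₃ i else 0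

/-- `φ(M) = a₀ M² + a₁ M + a₂ I`. -/
noncomputable def phiMat (a₀ a₁ a₂ : K) (M : Matrix ℕ ℕ K) : Matrix ℕ ℕ K :=
  a₀ • infMul M M + a₁ • M + a₂ • (1 : Matrix ℕ ℕ K)

/-- `ψ(M) = b₀ M + b₁ I`. -/
noncomputable def psiMat (b₀ b₁ : K) (M : Matrix ℕ ℕ K) : Matrix ℕ ℕ K :=
  b₀ • M + b₁ • (1 : Matrix ℕ ℕ K)

/-- `λ_n = n ((n - 1) a₀ + b₀)`. -/
def eigenval (a₀ b₀ : K) (n : ℕ) : K := (n : K) * (((n : K) - 1) * a₀ + b₀)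

/-- The Sylvester equation `A (D² φ(𝐗¹) + D G ψ(𝐗¹)) = Λ A`, with `Λ = diag(λ_0, λ_1, …)`. -/
def SylvesterEq (c₂ c₃ a₀ a₁ a₂ b₀ b₁ : K) (A : Matrix ℕ ℕ K) : Prop :=
  infMul A
      (infMul (infMul (matD K) (matD K)) (phiMat a₀ a₁ a₂ (matX1 c₂ c₃)) +
        infMul (infMul (matD K) (matG K)) (psiMat b₀ b₁ (matX1 c₂ c₃))) =
    infMul (Matrix.diagonal (eigenval a₀ b₀)) A

/-- The divided-difference equation `φ 𝔻² p + ψ 𝕊 𝔻 p = λ p`, with `φ = a₀ x² + a₁ x + a₂` and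
`ψ = b₀ x + b₁`. -/
def DividedDifferenceEq (c₂ c₃ a₀ a₁ a₂ b₀ b₁ lam : K) (p : K[X]) : Prop :=
  (C a₀ * X ^ 2 + C a₁ * X + C a₂) * divDiff c₂ c₃ (divDiff c₂ c₃ p) +
    (C b₀ * X + C b₁) * mean c₂ c₃ (divDiff c₂ c₃ p) = C lam * p

/-- The three-term recurrence relation `x P_n = P_{n+1} + β_n P_n + γ_n P_{n-1}` for `n ≥ 1`,
with the initial condition `P_1 = x - β_0`. -/
def ThreeTermRecurrence (P : ℕ → K[X]) (β γ : ℕ → K) : Prop :=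
  P 1 = X - C (β 0) ∧
    ∀ n, X * P (n + 1) = P (n + 2) + C (β (n + 1)) * P (n + 1) + C (γ (n + 1)) * P n

end QuadLattice

/-! ### Calculus of `𝔻` and `𝕊`: product rules, commutation relations, second-order operator. -/

namespace QuadLattice

variable {K : Type*} [Field K] [CharZero K]

/-! Put `T = φ 𝔻 + ψ 𝕊` and `L = T 𝔻 = φ 𝔻² + ψ 𝕊 𝔻`. In the basis `ϑ`, the matrices `D`, `G`, `𝐗¹`
represent `𝔻`, `𝕊` and multiplication by `x`, with rows as coordinate vectors. So the Sylvester
equation says `L P_n = λ_n P_n` for all `n`, and the rest concerns eigenvectors of `L`. Since `λ_n -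
λ_m = (n - m)((n + m - 1) a₀ + b₀)`, distinct eigenvalues mean `k a₀ + b₀ ≠ 0` for all `k`.

From eigenvectors to OPS. `L` and `x` satisfy a relation linear in `x` (`latticeOp_relation`). Its
`P_k`-coordinate on `P_n` is a scalar, nonzero for `k ≤ n - 2`, times the coordinate of `x P_n`;
this gives the three-term recurrence. Let `u` be the `P_0`-coordinate. As `λ_0 = 0`, `u` kills the
range of `L`, which is that of `T` because `𝔻` is onto. A Lagrange identity for `L`
(`mul_latticeOp_sub`) then makes the `P_n` orthogonal for `u`, with norms the products of the `γ_n`.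
A Leibniz rule (`latticeOp_mul`) carries this to the divided differences.

From classical OPS to eigenvectors. If `u`, `v` are functionals of `P` and of its divided
differences, then `v ∘ 𝔻` and `v ∘ 𝕊` vanish on `P_n` for large `n`, so they are polynomial
multiples of `u`. These polynomials determine `φ` and `ψ` with `u(g L f) = v(𝔻f 𝔻g)`; hence `L` is
diagonal in the `P_n`. -/

theorem mu_add_half_sub (c₂ c₃ t : K) :
    mu c₂ c₃ (t + 1 / 2) - mu c₂ c₃ (t - 1 / 2) = 2 * t + c₂ := by
  simp only [mu]; ring

/-- A polynomial is `divDiff c₂ c₃ p` as soon as it satisfies the defining relation. -/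
theorem eq_divDiff (c₂ c₃ : K) (p q : K[X])
    (h : ∀ t, (2 * t + c₂) * q.eval (mu c₂ c₃ t) =
      p.eval (mu c₂ c₃ (t + 1 / 2)) - p.eval (mu c₂ c₃ (t - 1 / 2))) : divDiff c₂ c₃ p = q := by
  refine eq_of_eval_mu c₂ c₃ _ _ fun t ht => mul_left_cancel₀ ht ?_
  rw [divDiff_spec, ← h, mu_add_half_sub]

theorem eq_mean (c₂ c₃ : K) (p q : K[X])
    (h : ∀ t, q.eval (mu c₂ c₃ t) =
      (p.eval (mu c₂ c₃ (t + 1 / 2)) + p.eval (mu c₂ c₃ (t - 1 / 2))) / 2) :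
    mean c₂ c₃ p = q :=
  eq_of_eval_mu c₂ c₃ _ _ fun t _ => by rw [mean_eval, h]

theorem divDiff_spec' (c₂ c₃ : K) (p : K[X]) (t : K) :
    (2 * t + c₂) * (divDiff c₂ c₃ p).eval (mu c₂ c₃ t) =
      p.eval (mu c₂ c₃ (t + 1 / 2)) - p.eval (mu c₂ c₃ (t - 1 / 2)) := by
  rw [← divDiff_spec, mu_add_half_sub]

/-- The divided-difference operator as a linear map. -/
noncomputable def divDiffLin (c₂ c₃ : K) : K[X] →ₗ[K] K[X] where
  toFun := divDiff c₂ c₃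
  map_add' p q := eq_divDiff _ _ _ _ fun t => by
    simp only [eval_add, mul_add, divDiff_spec']; ring
  map_smul' a p := eq_divDiff _ _ _ _ fun t => by
    simp only [eval_smul, smul_eq_mul, RingHom.id_apply, mul_left_comm _ a, divDiff_spec']; ring

/-- The averaging operator as a linear map. -/
noncomputable def meanLin (c₂ c₃ : K) : K[X] →ₗ[K] K[X] where
  toFun := mean c₂ c₃
  map_add' p q := eq_mean _ _ _ _ fun t => by
    simp only [eval_add, mean_eval]; ring
  map_smul' a p := eq_mean _ _ _ _ fun t => by
    simp only [eval_smul, smul_eq_mul, RingHom.id_apply, mean_eval]; ring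

theorem divDiff_eq_divDiffLin (c₂ c₃ : K) (p : K[X]) : divDiff c₂ c₃ p = divDiffLin c₂ c₃ p := rfl

theorem mean_eq_meanLin (c₂ c₃ : K) (p : K[X]) : mean c₂ c₃ p = meanLin c₂ c₃ p := rfl

theorem divDiffLin_mul (c₂ c₃ : K) (p q : K[X]) :
    divDiffLin c₂ c₃ (p * q) = divDiffLin c₂ c₃ p * meanLin c₂ c₃ q +
      meanLin c₂ c₃ p * divDiffLin c₂ c₃ q := by
  refine eq_divDiff _ _ _ _ fun t => ?_
  have hp := divDiff_spec' c₂ c₃ p t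
  have hq := divDiff_spec' c₂ c₃ q t
  simp only [← divDiff_eq_divDiffLin, ← mean_eq_meanLin, eval_add, eval_mul, mean_eval]
  linear_combination (eval (mu c₂ c₃ (t + 1 / 2)) q + eval (mu c₂ c₃ (t - 1 / 2)) q) / 2 * hp +
    (eval (mu c₂ c₃ (t + 1 / 2)) p + eval (mu c₂ c₃ (t - 1 / 2)) p) / 2 * hq

/-- The factor `x + c₂²/4 - c₃` is `(t + c₂/2)²`, the square of half the step `μ(t+1/2) - μ(t-1/2) =
2t + c₂`. -/
theorem meanLin_mul (c₂ c₃ : K) (p q : K[X]) :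
    meanLin c₂ c₃ (p * q) = meanLin c₂ c₃ p * meanLin c₂ c₃ q +
      (X + C (c₂ ^ 2 / 4 - c₃)) * (divDiffLin c₂ c₃ p * divDiffLin c₂ c₃ q) := by
  refine eq_mean _ _ _ _ fun t => ?_
  have hp := divDiff_spec' c₂ c₃ p t
  have hq := divDiff_spec' c₂ c₃ q t
  simp only [← divDiff_eq_divDiffLin, ← mean_eq_meanLin, eval_add, eval_mul, mean_eval,
    eval_X, eval_C]
  have e : mu c₂ c₃ t + (c₂ ^ 2 / 4 - c₃) = (2 * t + c₂) * (2 * t + c₂) / 4 := by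
    simp only [mu]; ring
  rw [e]
  linear_combination (2 * t + c₂) * eval (mu c₂ c₃ t) (divDiff c₂ c₃ q) / 4 * hp +
    (eval (mu c₂ c₃ (t + 1 / 2)) p - eval (mu c₂ c₃ (t - 1 / 2)) p) / 4 * hq

theorem divDiffLin_C (c₂ c₃ a : K) : divDiffLin c₂ c₃ (C a) = 0 :=
  eq_divDiff _ _ _ _ fun t => by simp

theorem meanLin_C (c₂ c₃ a : K) : meanLin c₂ c₃ (C a) = C a :=
  eq_mean _ _ _ _ fun t => by simp

theorem divDiffLin_X (c₂ c₃ : K) : divDiffLin c₂ c₃ X = 1 :=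
  eq_divDiff _ _ _ _ fun t => by simp [mu]; ring

theorem meanLin_X (c₂ c₃ : K) : meanLin c₂ c₃ X = X + C (1 / 4) :=
  eq_mean _ _ _ _ fun t => by simp only [mu, eval_add, eval_X, eval_C]; ring

theorem divDiffLin_one (c₂ c₃ : K) : divDiffLin c₂ c₃ 1 = 0 := divDiffLin_C c₂ c₃ 1

theorem meanLin_one (c₂ c₃ : K) : meanLin c₂ c₃ 1 = 1 := meanLin_C c₂ c₃ 1

/-- The product rules mix `𝔻` and `𝕊`, so both relations go through one induction on multiplication
by `x`. -/
theorem divDiffLin_meanLin_and (c₂ c₃ : K) (p : K[X]) :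
    divDiffLin c₂ c₃ (meanLin c₂ c₃ p) = meanLin c₂ c₃ (divDiffLin c₂ c₃ p) +
        C (1 / 2) * divDiffLin c₂ c₃ (divDiffLin c₂ c₃ p) ∧
      meanLin c₂ c₃ (meanLin c₂ c₃ p) = p +
        (X + C (c₂ ^ 2 / 4 - c₃)) * divDiffLin c₂ c₃ (divDiffLin c₂ c₃ p) +
        C (1 / 2) * meanLin c₂ c₃ (divDiffLin c₂ c₃ p) := by
  induction p using Polynomial.induction_on with
  | C a => simp [divDiffLin_C, meanLin_C]
  | add p q hp hq =>
    simp only [map_add, hp.1, hp.2, hq.1, hq.2]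
    constructor <;> ring
  | monomial n a h =>
    have e : (C a * X ^ (n + 1) : K[X]) = X * (C a * X ^ n) := by ring
    rw [e]
    generalize (C a * X ^ n : K[X]) = f at h ⊢
    simp only [map_add, divDiffLin_mul, meanLin_mul, divDiffLin_C, meanLin_C, divDiffLin_X,
      meanLin_X, divDiffLin_one, meanLin_one, h.1, h.2]
    constructor <;>
    · refine Polynomial.funext fun x => ?_
      simp only [eval_add, eval_mul, eval_X, eval_C, eval_zero, eval_one]
      ring

theorem divDiffLin_meanLin (c₂ c₃ : K) (p : K[X]) :
    divDiffLin c₂ c₃ (meanLin c₂ c₃ p) = meanLin c₂ c₃ (divDiffLin c₂ c₃ p) +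
      C (1 / 2) * divDiffLin c₂ c₃ (divDiffLin c₂ c₃ p) :=
  (divDiffLin_meanLin_and c₂ c₃ p).1

theorem meanLin_meanLin (c₂ c₃ : K) (p : K[X]) :
    meanLin c₂ c₃ (meanLin c₂ c₃ p) = p +
      (X + C (c₂ ^ 2 / 4 - c₃)) * divDiffLin c₂ c₃ (divDiffLin c₂ c₃ p) +
      C (1 / 2) * meanLin c₂ c₃ (divDiffLin c₂ c₃ p) :=
  (divDiffLin_meanLin_and c₂ c₃ p).2

/-- The first-order operator `φ 𝔻 + ψ 𝕊`. -/
noncomputable def pearsonOp (c₂ c₃ : K) (φ ψ : K[X]) : K[X] →ₗ[K] K[X] :=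
  LinearMap.mulLeft K φ ∘ₗ divDiffLin c₂ c₃ + LinearMap.mulLeft K ψ ∘ₗ meanLin c₂ c₃

/-- The second-order operator `φ 𝔻² + ψ 𝕊 𝔻`. -/
noncomputable def latticeOp (c₂ c₃ : K) (φ ψ : K[X]) : K[X] →ₗ[K] K[X] :=
  pearsonOp c₂ c₃ φ ψ ∘ₗ divDiffLin c₂ c₃

theorem pearsonOp_apply (c₂ c₃ : K) (φ ψ f : K[X]) :
    pearsonOp c₂ c₃ φ ψ f = φ * divDiffLin c₂ c₃ f + ψ * meanLin c₂ c₃ f := rfl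

theorem latticeOp_apply (c₂ c₃ : K) (φ ψ f : K[X]) :
    latticeOp c₂ c₃ φ ψ f = φ * divDiffLin c₂ c₃ (divDiffLin c₂ c₃ f) +
      ψ * meanLin c₂ c₃ (divDiffLin c₂ c₃ f) := rfl

/-- Lagrange identity: the antisymmetric defect of `L` lies in the range of `T`, hence is killed by
any functional `u` with `u ∘ T = 0`. -/
theorem mul_latticeOp_sub (c₂ c₃ : K) (φ ψ f g : K[X]) :
    g * latticeOp c₂ c₃ φ ψ f - f * latticeOp c₂ c₃ φ ψ g =
      pearsonOp c₂ c₃ φ ψ (divDiffLin c₂ c₃ f * meanLin c₂ c₃ g -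
        meanLin c₂ c₃ f * divDiffLin c₂ c₃ g) := by
  simp only [latticeOp_apply, pearsonOp_apply, map_sub, divDiffLin_mul, meanLin_mul,
    divDiffLin_meanLin, meanLin_meanLin]
  refine Polynomial.funext fun x => ?_
  simp only [eval_add, eval_sub, eval_mul, eval_X, eval_C]
  ring

/-- The operator `h ↦ T h + 2 φ 𝕊 h + 2 (x - c₃ + c₂²/4) ψ 𝔻 h` with `T = φ 𝔻 + ψ 𝕊`, which carries
the functional of a sequence to the functional of its divided differences. -/
noncomputable def gammaOp (c₂ c₃ : K) (φ ψ : K[X]) : K[X] →ₗ[K] K[X] :=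
  pearsonOp c₂ c₃ φ ψ + 2 • LinearMap.mulLeft K φ ∘ₗ meanLin c₂ c₃ +
    2 • LinearMap.mulLeft K ((X + C (c₂ ^ 2 / 4 - c₃)) * ψ) ∘ₗ divDiffLin c₂ c₃

theorem gammaOp_apply (c₂ c₃ : K) (φ ψ f : K[X]) :
    gammaOp c₂ c₃ φ ψ f = φ * divDiffLin c₂ c₃ f + ψ * meanLin c₂ c₃ f +
      2 • (φ * meanLin c₂ c₃ f) +
      2 • ((X + C (c₂ ^ 2 / 4 - c₃)) * ψ * divDiffLin c₂ c₃ f) := rfl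

theorem latticeOp_mul (c₂ c₃ : K) (φ ψ f g : K[X]) :
    latticeOp c₂ c₃ φ ψ (f * g) = g * latticeOp c₂ c₃ φ ψ f + f * latticeOp c₂ c₃ φ ψ g +
      gammaOp c₂ c₃ φ ψ (divDiffLin c₂ c₃ f * divDiffLin c₂ c₃ g) := by
  simp only [latticeOp_apply, gammaOp_apply, map_add, divDiffLin_mul, meanLin_mul,
    divDiffLin_meanLin, meanLin_meanLin]
  refine Polynomial.funext fun x => ?_
  simp only [eval_add, eval_mul, eval_X, eval_C, nsmul_eq_mul, Nat.cast_ofNat,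
    eval_ofNat]
  ring

theorem latticeOp_X_mul (c₂ c₃ : K) (φ ψ f : K[X]) :
    latticeOp c₂ c₃ φ ψ (X * f) = X * latticeOp c₂ c₃ φ ψ f +
      (ψ * f + (φ + φ + ψ) * meanLin c₂ c₃ (divDiffLin c₂ c₃ f) +
        (φ + ((X + C (c₂ ^ 2 / 4 - c₃)) * ψ + (X + C (c₂ ^ 2 / 4 - c₃)) * ψ)) *
          divDiffLin c₂ c₃ (divDiffLin c₂ c₃ f)) := by
  simp only [latticeOp_apply, map_add, divDiffLin_mul, meanLin_mul, divDiffLin_C, meanLin_C,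
    divDiffLin_X, meanLin_X, divDiffLin_one, meanLin_one, divDiffLin_meanLin, meanLin_meanLin]
  refine Polynomial.funext fun x => ?_
  simp only [eval_add, eval_mul, eval_X, eval_C, eval_zero, eval_one]
  ring

set_option maxRecDepth 10000 in
set_option maxHeartbeats 2000000 in
/-- The commutator with `L` of the operator `M = [L, x]`. -/
theorem latticeOp_commutator (c₂ c₃ a₀ a₁ a₂ b₀ b₁ : K) (φ ψ : K[X])
    (hφ : φ = C a₀ * (X * X) + C a₁ * X + C a₂) (hψ : ψ = C b₀ * X + C b₁)
    (L M : K[X] → K[X]) (hL : ∀ f, L f = latticeOp c₂ c₃ φ ψ f)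
    (hM : ∀ f, M f = ψ * f + (φ + φ + ψ) * meanLin c₂ c₃ (divDiffLin c₂ c₃ f) +
        (φ + ((X + C (c₂ ^ 2 / 4 - c₃)) * ψ + (X + C (c₂ ^ 2 / 4 - c₃)) * ψ)) *
          divDiffLin c₂ c₃ (divDiffLin c₂ c₃ f)) (f : K[X]) :
    L (M f) - M (L f) =
      C (2 * a₀) * (X * L f + X * L f + M f) + C (b₀ ^ 2 - 2 * a₀ * b₀) * (X * f) +
      (L (L f) + L (L f)) +
      C (2 * a₁ - b₀) * L f + C (b₁ * (b₀ - 2 * a₀)) * f := by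
  simp only [hL, hM, latticeOp_apply]
  -- Every word in `𝔻`, `𝕊` is first brought to the form `𝕊^ε 𝔻^i f` with `φ`, `ψ` opaque; their
  -- explicit form is needed only for the coefficients.
  simp only [map_add, divDiffLin_mul, meanLin_mul, divDiffLin_meanLin, meanLin_meanLin]
  subst hφ hψ
  simp only [map_add, map_zero, divDiffLin_mul, meanLin_mul, divDiffLin_C,
    meanLin_C, divDiffLin_X, meanLin_X, divDiffLin_one, meanLin_one, mul_zero,
    zero_mul, zero_add, add_zero, mul_one, one_mul]
  refine Polynomial.funext fun x => ?_
  simp only [eval_add, eval_sub, eval_mul, eval_X, eval_C, eval_one]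
  ring

/-- The cubic relation between the second-order operator `L` and multiplication by `x`:
`[L, [L, x]] = 2 a₀ (L x + x L) + (b₀² - 2 a₀ b₀) x + 2 L² + (2 a₁ - b₀) L + b₁ (b₀ - 2 a₀)`. -/
theorem latticeOp_relation (c₂ c₃ a₀ a₁ a₂ b₀ b₁ : K) (L : K[X] →ₗ[K] K[X])
    (hL : L = latticeOp c₂ c₃ (C a₀ * X ^ 2 + C a₁ * X + C a₂) (C b₀ * X + C b₁)) (f : K[X]) :
    L (L (X * f)) - 2 * L (X * L f) + X * L (L f) =
      C (2 * a₀) * (L (X * f) + X * L f) + C (b₀ ^ 2 - 2 * a₀ * b₀) * (X * f) + 2 * L (L f) +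
      C (2 * a₁ - b₀) * L f + C (b₁ * (b₀ - 2 * a₀)) * f := by
  -- The product rules apply to `X * X`, the form used in the commutator identity.
  rw [pow_two] at hL
  subst hL
  have := latticeOp_commutator c₂ c₃ a₀ a₁ a₂ b₀ b₁ _ _ rfl rfl _ _
    (fun f => rfl) (fun f => rfl) f
  rw [latticeOp_X_mul, latticeOp_X_mul, map_add, latticeOp_X_mul]
  linear_combination this

end QuadLattice

/-! ### The Sylvester equation as an operator equation in the basis `ϑ`. -/

namespace QuadLattice

variable {K : Type*} [Field K]

/-- `ϑ_n` as a polynomial in the lattice. -/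
noncomputable def thetaPoly (c₂ c₃ : K) (n : ℕ) : K[X] :=
  ∏ k ∈ Finset.range n, (X - C (fCoeff c₂ c₃ k))

theorem thetaPoly_succ (c₂ c₃ : K) (n : ℕ) :
    thetaPoly c₂ c₃ (n + 1) = thetaPoly c₂ c₃ n * (X - C (fCoeff c₂ c₃ n)) :=
  Finset.prod_range_succ _ _

theorem IsMonicSeq.degree_eq {P : ℕ → K[X]} (hP : IsMonicSeq P) (n : ℕ) : (P n).degree = n := by
  rw [degree_eq_natDegree (hP n).1.ne_zero, (hP n).2]

/-- A sequence of monic polynomials of degrees `0, 1, 2, …` as a basis. -/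
noncomputable def IsMonicSeq.basis {P : ℕ → K[X]} (hP : IsMonicSeq P) : Module.Basis ℕ K K[X] :=
  Polynomial.Sequence.basis ⟨P, hP.degree_eq⟩ fun i => by
    change IsUnit (P i).leadingCoeff
    rw [(hP i).1.leadingCoeff]; exact isUnit_one

@[simp]
theorem IsMonicSeq.basis_apply {P : ℕ → K[X]} (hP : IsMonicSeq P) (n : ℕ) :
    hP.basis n = P n := by
  simp [IsMonicSeq.basis]

theorem isMonicSeq_thetaPoly (c₂ c₃ : K) : IsMonicSeq (thetaPoly c₂ c₃) := fun n =>
  ⟨monic_prod_of_monic _ _ fun k _ => monic_X_sub_C _, by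
    rw [thetaPoly, natDegree_prod_of_monic _ _ fun k _ => monic_X_sub_C _]; simp⟩

/-- The matrix of the coordinates of the vectors `q i` in a basis. -/
noncomputable def coordMatrix {V : Type*} [AddCommGroup V] [Module K V] (b : Module.Basis ℕ K V)
    (q : ℕ → V) : Matrix ℕ ℕ K :=
  fun i j => b.repr (q i) j

section coordMatrix

variable {V : Type*} [AddCommGroup V] [Module K V] (b : Module.Basis ℕ K V)

theorem coordMatrix_injective : Function.Injective (coordMatrix b) := fun _ _ h =>
  funext fun i => b.repr.injective (Finsupp.ext fun j => congrFun (congrFun h i) j)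

/-- Rows are coordinate vectors, so operators act by multiplication on the right and matrix products
read in order of application: `D² φ(𝐗¹)` is `𝔻` twice, then `φ`. Rows have finite support, so the
`finsum` is a genuine sum. -/
theorem infMul_coordMatrix (q : ℕ → V) (T : V →ₗ[K] V) :
    infMul (coordMatrix b q) (coordMatrix b fun k => T (b k)) = coordMatrix b fun i => T (q i) := by
  ext i j
  have h : T (q i) = (b.repr (q i)).sum fun k c => c • T (b k) := by
    conv_lhs => rw [← b.linearCombination_repr (q i), Finsupp.linearCombination_apply]
    simp [Finsupp.sum, map_sum]
  simp only [infMul, coordMatrix]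
  rw [h, finsum_eq_sum_of_support_subset (s := (b.repr (q i)).support)]
  · simp [Finsupp.sum, map_sum, Finsupp.finsetSum_apply]
  · intro k hk
    simp only [Function.mem_support] at hk
    simpa using left_ne_zero_of_mul hk

theorem coordMatrix_add (q r : ℕ → V) :
    coordMatrix b q + coordMatrix b r = coordMatrix b fun i => q i + r i := by
  ext i j; simp [coordMatrix]

theorem smul_coordMatrix (a : K) (q : ℕ → V) :
    a • coordMatrix b q = coordMatrix b fun i => a • q i := by
  ext i j; simp [coordMatrix]

theorem one_eq_coordMatrix : (1 : Matrix ℕ ℕ K) = coordMatrix b fun i => b i := by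
  ext i j; simp [coordMatrix, Matrix.one_apply, Finsupp.single_apply]

theorem infMul_diagonal (d : ℕ → K) (M : Matrix ℕ ℕ K) :
    infMul (Matrix.diagonal d) M = fun i j => d i * M i j := by
  ext i j
  rw [infMul, finsum_eq_single _ i fun k hk => by rw [Matrix.diagonal_apply_ne' _ hk, zero_mul],
    Matrix.diagonal_apply_eq]

end coordMatrix

/-- The basis of the `ϑ_n`. -/
noncomputable abbrev thetaBasis (c₂ c₃ : K) : Module.Basis ℕ K K[X] :=
  (isMonicSeq_thetaPoly c₂ c₃).basis

theorem repr_thetaPoly (c₂ c₃ : K) (n k : ℕ) :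
    (thetaBasis c₂ c₃).repr (thetaPoly c₂ c₃ n) k = if n = k then 1 else 0 := by
  rw [← (isMonicSeq_thetaPoly c₂ c₃).basis_apply, Module.Basis.repr_self, Finsupp.single_apply]

theorem matX1_eq_coordMatrix (c₂ c₃ : K) :
    matX1 c₂ c₃ =
      coordMatrix (thetaBasis c₂ c₃) fun k => LinearMap.mulLeft K X (thetaBasis c₂ c₃ k) := by
  ext i j
  simp only [matX1, coordMatrix, IsMonicSeq.basis_apply, LinearMap.mulLeft_apply]
  rw [show X * thetaPoly c₂ c₃ i = thetaPoly c₂ c₃ (i + 1) + fCoeff c₂ c₃ i • thetaPoly c₂ c₃ i by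
      rw [thetaPoly_succ, smul_eq_C_mul]; ring, map_add, map_smul, Finsupp.add_apply,
    Finsupp.smul_apply, repr_thetaPoly, repr_thetaPoly]
  by_cases h : j = i + 1
  · subst h; simp
  · simp [h, Ne.symm h]

variable [CharZero K]

/-- The `n`-th pair of Pochhammer factors multiplies to `(n + 1/2)² - (2t + c₂)² = -4 (μ(t) - f_n)`.
-/
theorem eval_thetaPoly (c₂ c₃ : K) (n : ℕ) (t : K) :
    (thetaPoly c₂ c₃ n).eval (mu c₂ c₃ t) = theta c₂ n t := by
  induction n with
  | zero => simp [thetaPoly, theta]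
  | succ n ih =>
    rw [thetaPoly_succ, eval_mul, ih]
    simp only [theta, ascPochhammer_succ_right, eval_mul, eval_add, eval_X, eval_natCast, eval_sub,
      eval_C, pow_succ, mul_inv, fCoeff, mu]
    have h4 : (-4 : K)⁻¹ * (-4) = 1 := inv_mul_cancel₀ (by norm_num)
    linear_combination -((-4 : K) ^ n)⁻¹ * (ascPochhammer K n).eval (2 * t + 1 / 2 + c₂) *
      (ascPochhammer K n).eval (-2 * t + 1 / 2 - c₂) * (t ^ 2 + c₂ * t + c₂ ^ 2 / 4 -
        1 / 16 * (2 * (n : K) + 1) ^ 2) * h4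

theorem divDiffLin_thetaPoly_and (c₂ c₃ : K) (n : ℕ) :
    divDiffLin c₂ c₃ (thetaPoly c₂ c₃ (n + 1)) = C ((n : K) + 1) * thetaPoly c₂ c₃ n ∧
      meanLin c₂ c₃ (thetaPoly c₂ c₃ (n + 1)) = thetaPoly c₂ c₃ (n + 1) +
        C (gCoeff K (n + 1)) * thetaPoly c₂ c₃ n := by
  induction n with
  | zero =>
    rw [thetaPoly_succ]
    simp only [thetaPoly, Finset.range_zero, Finset.prod_empty, one_mul, map_sub, divDiffLin_X,
      divDiffLin_C, meanLin_X, meanLin_C, gCoeff, fCoeff]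
    constructor <;>
    · refine Polynomial.funext fun x => ?_
      simp only [eval_add, eval_sub, eval_mul, eval_X, eval_C, eval_zero, eval_one]
      push_cast
      ring
  | succ n ih =>
    rw [thetaPoly_succ c₂ c₃ (n + 1), divDiffLin_mul, meanLin_mul, ih.1, ih.2]
    simp only [map_sub, divDiffLin_X, divDiffLin_C, meanLin_X, meanLin_C, gCoeff,
      thetaPoly_succ, fCoeff]
    constructor <;>
    · refine Polynomial.funext fun x => ?_
      simp only [eval_add, eval_sub, eval_mul, eval_X, eval_C, eval_zero, eval_one]
      push_cast
      ring

theorem matD_eq_coordMatrix (c₂ c₃ : K) :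
    matD K = coordMatrix (thetaBasis c₂ c₃) fun k => divDiffLin c₂ c₃ (thetaBasis c₂ c₃ k) := by
  ext i j
  simp only [matD, coordMatrix, IsMonicSeq.basis_apply]
  cases i with
  | zero => simp [thetaPoly, divDiffLin_one]
  | succ n =>
    rw [(divDiffLin_thetaPoly_and c₂ c₃ n).1, ← smul_eq_C_mul, map_smul, Finsupp.smul_apply,
      repr_thetaPoly]
    simp

theorem matG_eq_coordMatrix (c₂ c₃ : K) :
    matG K = coordMatrix (thetaBasis c₂ c₃) fun k => meanLin c₂ c₃ (thetaBasis c₂ c₃ k) := by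
  ext i j
  simp only [matG, coordMatrix, IsMonicSeq.basis_apply]
  cases i with
  | zero =>
    rw [show meanLin c₂ c₃ (thetaPoly c₂ c₃ 0) = thetaPoly c₂ c₃ 0 by simp [thetaPoly, meanLin_one],
      repr_thetaPoly]
    simp
  | succ n =>
    rw [(divDiffLin_thetaPoly_and c₂ c₃ n).2, ← smul_eq_C_mul, map_add, map_smul, Finsupp.add_apply,
      Finsupp.smul_apply, repr_thetaPoly, repr_thetaPoly]
    by_cases h : n + 1 = j
    · subst h; simp
    · simp [h]

theorem IsCoeffMatrix.eq_coordMatrix {c₂ c₃ : K} {P : ℕ → K[X]} {A : Matrix ℕ ℕ K}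
    (hA : IsCoeffMatrix c₂ c₃ P A) : A = coordMatrix (thetaBasis c₂ c₃) P := by
  ext i j
  have h : P i = ∑ k ∈ Finset.range (i + 1), A i k • thetaPoly c₂ c₃ k :=
    eq_of_eval_mu c₂ c₃ _ _ fun t _ => by
      rw [hA.2 i t, eval_finsetSum]
      simp [eval_thetaPoly]
  rw [coordMatrix, h]
  simp only [map_sum, map_smul, Finsupp.finsetSum_apply, Finsupp.smul_apply, repr_thetaPoly]
  simp only [smul_eq_mul, mul_ite, mul_one, mul_zero, Finset.sum_ite_eq', Finset.mem_range]
  split_ifs with hj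
  · rfl
  · exact hA.1 i j (by omega)

theorem sylvesterEq_iff {c₂ c₃ : K} {P : ℕ → K[X]} {A : Matrix ℕ ℕ K}
    (hA : IsCoeffMatrix c₂ c₃ P A) (a₀ a₁ a₂ b₀ b₁ : K) :
    SylvesterEq c₂ c₃ a₀ a₁ a₂ b₀ b₁ A ↔
      ∀ n, DividedDifferenceEq c₂ c₃ a₀ a₁ a₂ b₀ b₁ (eigenval a₀ b₀ n) (P n) := by
  have hD := matD_eq_coordMatrix c₂ c₃
  have hG := matG_eq_coordMatrix c₂ c₃
  have hX := matX1_eq_coordMatrix c₂ c₃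
  have hA := hA.eq_coordMatrix
  -- Of the basis only the matrices of `𝔻`, `𝕊` and `x` matter from here on.
  generalize thetaBasis c₂ c₃ = b at hD hG hX hA
  have hφ : phiMat a₀ a₁ a₂ (matX1 c₂ c₃) = coordMatrix b fun k =>
      LinearMap.mulLeft K (C a₀ * X ^ 2 + C a₁ * X + C a₂) (b k) := by
    rw [phiMat, hX, infMul_coordMatrix, one_eq_coordMatrix b]
    simp only [smul_coordMatrix, coordMatrix_add, smul_eq_C_mul, LinearMap.mulLeft_apply]
    congr 1; ext1 k; ring
  have hψ : psiMat b₀ b₁ (matX1 c₂ c₃) = coordMatrix b fun k =>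
      LinearMap.mulLeft K (C b₀ * X + C b₁) (b k) := by
    rw [psiMat, hX, one_eq_coordMatrix b]
    simp only [smul_coordMatrix, coordMatrix_add, smul_eq_C_mul, LinearMap.mulLeft_apply]
    congr 1; ext1 k; ring
  have hΛ : infMul (Matrix.diagonal (eigenval a₀ b₀)) (coordMatrix b P) =
      coordMatrix b fun n => eigenval a₀ b₀ n • P n := by
    rw [infMul_diagonal]; ext i j; simp [coordMatrix]
  have hL := infMul_coordMatrix b P
    (latticeOp c₂ c₃ (C a₀ * X ^ 2 + C a₁ * X + C a₂) (C b₀ * X + C b₁))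
  simp only [latticeOp_apply] at hL
  rw [SylvesterEq, hφ, hψ, hD, hG, hA, hΛ]
  simp only [infMul_coordMatrix, coordMatrix_add]
  simp only [LinearMap.mulLeft_apply]
  rw [hL, (coordMatrix_injective b).eq_iff, funext_iff]
  simp only [DividedDifferenceEq, smul_eq_C_mul]
  rfl

end QuadLattice

/-! ### Monic sequences, orthogonality functionals, and degrees. -/

namespace QuadLattice

variable {K : Type*} [Field K]

theorem IsMonicSeq.span_eq_degreeLT {P : ℕ → K[X]} (hP : IsMonicSeq P) (n : ℕ) :
    Submodule.span K (P '' Set.Iio n) = degreeLT K n :=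
  Polynomial.Sequence.span_degreeLT ⟨P, hP.degree_eq⟩ fun i _ => by
    change IsUnit (P i).leadingCoeff
    rw [(hP i).1.leadingCoeff]; exact isUnit_one

theorem IsMonicSeq.repr_self {P : ℕ → K[X]} (hP : IsMonicSeq P) (n k : ℕ) :
    hP.basis.repr (P n) k = if n = k then 1 else 0 := by
  rw [← hP.basis_apply, Module.Basis.repr_self, Finsupp.single_apply]

theorem IsMonicSeq.repr_eq_zero {P : ℕ → K[X]} (hP : IsMonicSeq P) {p : K[X]} {n k : ℕ}
    (hp : p.degree < n) (hk : n ≤ k) : hP.basis.repr p k = 0 := by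
  rw [← mem_degreeLT, ← hP.span_eq_degreeLT,
    show P = hP.basis from funext fun i => (hP.basis_apply i).symm,
    Module.Basis.mem_span_image] at hp
  by_contra h
  exact absurd (hp (Finsupp.mem_support_iff.2 h)) (not_lt.2 hk)

theorem IsMonicSeq.coeff_self {P : ℕ → K[X]} (hP : IsMonicSeq P) (n : ℕ) : (P n).coeff n = 1 := by
  have := (hP n).1.coeff_natDegree
  rwa [(hP n).2] at this

theorem IsMonicSeq.degree_sub_smul_lt {P : ℕ → K[X]} (hP : IsMonicSeq P) {p : K[X]} {n : ℕ}
    (hp : p.degree < (n + 1 : ℕ)) : (p - p.coeff n • P n).degree < n := by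
  rw [degree_lt_iff_coeff_zero] at hp ⊢
  intro m hm
  rcases hm.eq_or_lt with rfl | hm
  · rw [coeff_sub, coeff_smul, hP.coeff_self]; simp
  · rw [coeff_sub, coeff_smul, hp m hm, coeff_eq_zero_of_natDegree_lt ((hP n).2.trans_lt hm)]
    simp

theorem IsMonicSeq.degree_lt_succ {P : ℕ → K[X]} (hP : IsMonicSeq P) (n : ℕ) :
    (P n).degree < (n + 1 : ℕ) := by
  rw [hP.degree_eq]; exact_mod_cast n.lt_succ_self

theorem IsMonicSeq.apply_zero {P : ℕ → K[X]} (hP : IsMonicSeq P) : P 0 = 1 :=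
  (hP 0).1.natDegree_eq_zero.1 (hP 0).2

theorem IsMonicSeq.degree_X_mul_lt {P : ℕ → K[X]} (hP : IsMonicSeq P) (n : ℕ) :
    (X * P n : K[X]).degree < (n + 2 : ℕ) := by
  rw [degree_mul, hP.degree_eq, degree_X]
  norm_cast
  omega

theorem IsMonicSeq.repr_X_mul {P : ℕ → K[X]} (hP : IsMonicSeq P) (n : ℕ) :
    hP.basis.repr (X * P n) (n + 1) = 1 := by
  have h := hP.degree_sub_smul_lt (hP.degree_X_mul_lt n)
  rw [coeff_X_mul, hP.coeff_self, one_smul] at h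
  have h' := hP.repr_eq_zero h le_rfl
  rw [map_sub, Finsupp.sub_apply, hP.repr_self, if_pos rfl] at h'
  exact sub_eq_zero.1 h'

/-- The functional vanishing on `P_m P_n` for `m ≠ n` vanishes on `p P_n` for `deg p < n`. -/
theorem IsMonicSeq.map_mul_eq_zero {P : ℕ → K[X]} (hP : IsMonicSeq P) {u : K[X] →ₗ[K] K}
    (hu : ∀ m n, m ≠ n → u (P m * P n) = 0) {p : K[X]} {n : ℕ} (hp : p.degree < n) :
    u (p * P n) = 0 := by
  rw [← mem_degreeLT, ← hP.span_eq_degreeLT] at hp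
  induction hp using Submodule.span_induction with
  | mem x hx =>
    obtain ⟨i, hi, rfl⟩ := hx
    exact hu i n (ne_of_lt hi)
  | zero => simp
  | add x y _ _ hx hy => rw [add_mul, map_add, hx, hy, add_zero]
  | smul a x _ hx => rw [smul_mul_assoc, map_smul, hx, smul_zero]

theorem IsMonicSeq.map_mul_eq_repr {P : ℕ → K[X]} (hP : IsMonicSeq P) {u : K[X] →ₗ[K] K}
    (hu : ∀ m n, m ≠ n → u (P m * P n) = 0) (p : K[X]) (n : ℕ) :
    u (p * P n) = hP.basis.repr p n * u (P n * P n) := by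
  have : u ∘ₗ LinearMap.mulRight K (P n) = u (P n * P n) • hP.basis.coord n := by
    refine hP.basis.ext fun m => ?_
    by_cases h : m = n
    · subst h; simp [hP.repr_self]
    · simp [hP.repr_self, h, hu m n h]
  have := LinearMap.congr_fun this p
  simp only [LinearMap.comp_apply, LinearMap.mulRight_apply, LinearMap.smul_apply,
    Module.Basis.coord_apply, smul_eq_mul] at this
  rw [this, mul_comm]

/-- A functional vanishing on `P_n` for `n ≥ N` is a polynomial of degree less than `N` times the
orthogonality functional. -/
theorem IsMonicSeq.exists_functional_eq {P : ℕ → K[X]} (hP : IsMonicSeq P) {u : K[X] →ₗ[K] K}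
    (hu : ∀ m n, m ≠ n → u (P m * P n) = 0) (hu' : ∀ n, u (P n * P n) ≠ 0) (w : K[X] →ₗ[K] K)
    (N : ℕ) (hw : ∀ n, N ≤ n → w (P n) = 0) :
    ∃ χ : K[X], χ.degree < N ∧ ∀ f, w f = u (χ * f) := by
  refine ⟨∑ k ∈ Finset.range N, (w (P k) / u (P k * P k)) • P k, ?_, fun f => ?_⟩
  · rw [← mem_degreeLT]
    refine Submodule.sum_mem _ fun k hk => Submodule.smul_mem _ _ ?_
    rw [mem_degreeLT, hP.degree_eq]
    exact_mod_cast Finset.mem_range.1 hk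
  · have : w = u ∘ₗ LinearMap.mulLeft K
        (∑ k ∈ Finset.range N, (w (P k) / u (P k * P k)) • P k) := by
      refine hP.basis.ext fun n => ?_
      simp only [hP.basis_apply, LinearMap.comp_apply, LinearMap.mulLeft_apply, Finset.sum_mul,
        map_sum, smul_mul_assoc, map_smul, smul_eq_mul]
      by_cases hn : n < N
      · rw [Finset.sum_eq_single_of_mem n (Finset.mem_range.2 hn) fun k _ hk => by
          rw [hu k n hk, mul_zero], div_mul_cancel₀ _ (hu' n)]
      · rw [hw n (not_lt.1 hn), Finset.sum_eq_zero fun k hk => ?_]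
        rw [hu k n (by have := Finset.mem_range.1 hk; omega), mul_zero]
    conv_lhs => rw [this]
    rfl

/-- Both sides equal `u(x P_n P_{n+1})`: expand `x P_n` for one, `x P_{n+1}` for the other. -/
theorem ThreeTermRecurrence.map_mul_self {P : ℕ → K[X]} (hP : IsMonicSeq P) {β γ : ℕ → K}
    (h : ThreeTermRecurrence P β γ) {u : K[X] →ₗ[K] K}
    (hu : ∀ m n, m ≠ n → u (P m * P n) = 0) (n : ℕ) :
    u (P (n + 1) * P (n + 1)) = γ (n + 1) * u (P n * P n) := by
  have h1 : u (X * P n * P (n + 1)) = u (P (n + 1) * P (n + 1)) := by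
    have := hP.map_mul_eq_repr hu (X * P n) (n + 1)
    rwa [hP.repr_X_mul, one_mul] at this
  rw [← h1, mul_assoc, mul_left_comm, h.2 n, mul_comm]
  simp only [add_mul, map_add, ← smul_eq_C_mul, smul_mul_assoc, map_smul]
  rw [hu _ _ (by omega : n + 2 ≠ n), hu _ _ (by omega : n + 1 ≠ n)]
  simp

theorem eigenval_sub (a₀ b₀ : K) (n m : ℕ) : eigenval a₀ b₀ n - eigenval a₀ b₀ m =
    ((n : K) - m) * (((n : K) + m - 1) * a₀ + b₀) := by
  simp only [eigenval]; ring

section Degree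

variable [CharZero K]

theorem eigenval_injective_iff (a₀ b₀ : K) :
    (∀ n m, n ≠ m → eigenval a₀ b₀ n ≠ eigenval a₀ b₀ m) ↔ ∀ k : ℕ, (k : K) * a₀ + b₀ ≠ 0 := by
  constructor
  · intro h k hk
    refine h (k + 1) 0 (by omega) (sub_eq_zero.1 ?_)
    rw [eigenval_sub]; push_cast
    linear_combination ((k : K) + 1) * hk
  · intro h n m hnm he
    have h0 := eigenval_sub a₀ b₀ n m
    rw [he, sub_self, eq_comm, mul_eq_zero, sub_eq_zero] at h0
    -- Since `n ≠ m`, the sum `n + m` is positive and `n + m - 1` is a natural number.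
    obtain ⟨k, hk⟩ : ∃ k, n + m = k + 1 := ⟨n + m - 1, by omega⟩
    have hk' : (n : K) + m - 1 = k := by
      rw [sub_eq_iff_eq_add]; exact_mod_cast hk
    rcases h0 with h0 | h0
    · exact hnm (by exact_mod_cast h0)
    · rw [hk'] at h0; exact h k h0

theorem divDiffLin_mem_degreeLT (c₂ c₃ : K) {p : K[X]} {n : ℕ} (hp : p.degree < (n + 1 : ℕ)) :
    (divDiffLin c₂ c₃ p).degree < n := by
  rw [← mem_degreeLT] at hp ⊢
  rw [← (isMonicSeq_thetaPoly c₂ c₃).span_eq_degreeLT] at hp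
  rw [← Submodule.mem_comap]
  refine Submodule.span_le.2 ?_ hp
  rintro _ ⟨i, hi, rfl⟩
  rw [SetLike.mem_coe, Submodule.mem_comap]
  cases i with
  | zero => simp [(isMonicSeq_thetaPoly c₂ c₃).apply_zero, divDiffLin_one]
  | succ i =>
    rw [(divDiffLin_thetaPoly_and c₂ c₃ i).1, ← smul_eq_C_mul]
    refine Submodule.smul_mem _ _ ?_
    rw [mem_degreeLT, (isMonicSeq_thetaPoly c₂ c₃).degree_eq]
    exact_mod_cast Nat.lt_of_succ_lt_succ hi

theorem meanLin_mem_degreeLT (c₂ c₃ : K) {p : K[X]} {n : ℕ} (hp : p.degree < n) :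
    (meanLin c₂ c₃ p).degree < n := by
  rw [← mem_degreeLT] at hp ⊢
  rw [← (isMonicSeq_thetaPoly c₂ c₃).span_eq_degreeLT] at hp
  rw [← Submodule.mem_comap]
  refine Submodule.span_le.2 ?_ hp
  rintro _ ⟨i, hi, rfl⟩
  rw [SetLike.mem_coe, Submodule.mem_comap]
  have h : ∀ j ≤ i, thetaPoly c₂ c₃ j ∈ degreeLT K n := fun j hj => by
    rw [mem_degreeLT, (isMonicSeq_thetaPoly c₂ c₃).degree_eq]
    exact_mod_cast lt_of_le_of_lt hj hi
  cases i with
  | zero =>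
    have := h 0 le_rfl
    rwa [(isMonicSeq_thetaPoly c₂ c₃).apply_zero, meanLin_one,
      ← (isMonicSeq_thetaPoly c₂ c₃).apply_zero]
  | succ i =>
    rw [(divDiffLin_thetaPoly_and c₂ c₃ i).2, ← smul_eq_C_mul]
    exact Submodule.add_mem _ (h _ le_rfl) (Submodule.smul_mem _ _ (h _ i.le_succ))

/-- Subtracting the right multiple of `ϑ_{n+1}` lowers the degree, so only `𝔻 ϑ_{n+1}` contributes.
-/
theorem coeff_divDiffLin (c₂ c₃ : K) {p : K[X]} {n : ℕ} (hp : p.degree < (n + 2 : ℕ)) :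
    (divDiffLin c₂ c₃ p).coeff n = ((n : K) + 1) * p.coeff (n + 1) := by
  have hθ := isMonicSeq_thetaPoly c₂ c₃
  have h := divDiffLin_mem_degreeLT c₂ c₃ (hθ.degree_sub_smul_lt hp)
  have h' := coeff_eq_zero_of_degree_lt h
  rw [map_sub, map_smul, coeff_sub, coeff_smul, (divDiffLin_thetaPoly_and c₂ c₃ n).1, coeff_C_mul,
    hθ.coeff_self, smul_eq_mul] at h'
  linear_combination h'

theorem coeff_meanLin (c₂ c₃ : K) {p : K[X]} {n : ℕ} (hp : p.degree < (n + 1 : ℕ)) :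
    (meanLin c₂ c₃ p).coeff n = p.coeff n := by
  have hθ := isMonicSeq_thetaPoly c₂ c₃
  have h := meanLin_mem_degreeLT c₂ c₃ (hθ.degree_sub_smul_lt hp)
  have h' := coeff_eq_zero_of_degree_lt h
  have h1 : (meanLin c₂ c₃ (thetaPoly c₂ c₃ n)).coeff n = 1 := by
    cases n with
    | zero => simp [hθ.apply_zero, meanLin_one]
    | succ n =>
      rw [(divDiffLin_thetaPoly_and c₂ c₃ n).2, coeff_add, coeff_C_mul, hθ.coeff_self,
        coeff_eq_zero_of_degree_lt (hθ.degree_lt_succ n), mul_zero, add_zero]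
  rw [map_sub, map_smul, coeff_sub, coeff_smul, h1, smul_eq_mul] at h'
  linear_combination h'

theorem isMonicSeq_derivedSeq (c₂ c₃ : K) {P : ℕ → K[X]} (hP : IsMonicSeq P) :
    IsMonicSeq (derivedSeq c₂ c₃ P) := fun n => by
  have hn : ((n : K) + 1) ≠ 0 := by exact_mod_cast n.succ_ne_zero
  have hd : (derivedSeq c₂ c₃ P n).degree < (n + 1 : ℕ) := by
    rw [derivedSeq, divDiff_eq_divDiffLin, ← smul_eq_C_mul, ← mem_degreeLT]
    exact Submodule.smul_mem _ _
      (mem_degreeLT.2 (divDiffLin_mem_degreeLT c₂ c₃ (hP.degree_lt_succ (n + 1))))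
  have hc : (derivedSeq c₂ c₃ P n).coeff n = 1 := by
    rw [derivedSeq, divDiff_eq_divDiffLin, coeff_C_mul,
      coeff_divDiffLin c₂ c₃ (hP.degree_lt_succ (n + 1)), hP.coeff_self]
    field_simp
  have hle : (derivedSeq c₂ c₃ P n).natDegree ≤ n :=
    Nat.lt_succ_iff.1 ((natDegree_lt_iff_degree_lt (fun h0 => by simp [h0] at hc)).2 hd)
  exact ⟨monic_of_natDegree_le_of_coeff_eq_one n hle hc,
    natDegree_eq_of_le_of_coeff_ne_zero hle (by rw [hc]; exact one_ne_zero)⟩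

theorem divDiffLin_eq_derivedSeq (c₂ c₃ : K) (P : ℕ → K[X]) (n : ℕ) :
    divDiffLin c₂ c₃ (P (n + 1)) = ((n : K) + 1) • derivedSeq c₂ c₃ P n := by
  have hn : ((n : K) + 1) ≠ 0 := by exact_mod_cast n.succ_ne_zero
  rw [derivedSeq, ← smul_eq_C_mul, smul_smul, mul_one_div_cancel hn, one_smul]
  rfl

theorem divDiffLin_surjective (c₂ c₃ : K) : Function.Surjective (divDiffLin c₂ c₃) := by
  rw [← LinearMap.range_eq_top, eq_top_iff, ← (thetaBasis c₂ c₃).span_eq, Submodule.span_le]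
  rintro _ ⟨n, rfl⟩
  have hn : ((n : K) + 1) ≠ 0 := by exact_mod_cast n.succ_ne_zero
  refine ⟨((n : K) + 1)⁻¹ • thetaPoly c₂ c₃ (n + 1), ?_⟩
  rw [map_smul, (divDiffLin_thetaPoly_and c₂ c₃ n).1, ← smul_eq_C_mul, smul_smul,
    inv_mul_cancel₀ hn, one_smul, IsMonicSeq.basis_apply]

end Degree

end QuadLattice

/-! ### Eigenvectors of `L` and classical OPS. -/

namespace QuadLattice

variable {K : Type*} [Field K]

theorem IsMonicSeq.repr_eigen {P : ℕ → K[X]} (hP : IsMonicSeq P) {L : K[X] →ₗ[K] K[X]}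
    {l : ℕ → K} (hL : ∀ n, L (P n) = l n • P n) (p : K[X]) (k : ℕ) :
    hP.basis.repr (L p) k = l k * hP.basis.repr p k := by
  have : hP.basis.coord k ∘ₗ L = l k • hP.basis.coord k := by
    refine hP.basis.ext fun m => ?_
    by_cases h : m = k
    · subst h; simp [hP.repr_self, hL]
    · simp [hP.repr_self, h, hL]
  exact LinearMap.congr_fun this p

theorem ThreeTermRecurrence.ne_zero_of_isOPS {P : ℕ → K[X]} {β γ : ℕ → K}
    (hr : ThreeTermRecurrence P β γ) (h : IsOPS P) (n : ℕ) (hn : 1 ≤ n) : γ n ≠ 0 := by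
  obtain ⟨hP, u, hu, hu'⟩ := h
  obtain ⟨k, rfl⟩ := Nat.exists_eq_add_of_le' hn
  have := hu' (k + 1)
  rw [hr.map_mul_self hP hu] at this
  exact left_ne_zero_of_mul this

variable [CharZero K]

theorem dividedDifferenceEq_iff (c₂ c₃ a₀ a₁ a₂ b₀ b₁ lam : K) (p : K[X]) :
    DividedDifferenceEq c₂ c₃ a₀ a₁ a₂ b₀ b₁ lam p ↔
      latticeOp c₂ c₃ (C a₀ * X ^ 2 + C a₁ * X + C a₂) (C b₀ * X + C b₁) p = lam • p := by
  rw [smul_eq_C_mul]; rfl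

theorem coeff_pearsonOp (c₂ c₃ a₀ a₁ a₂ b₀ b₁ : K) {h : K[X]} {n : ℕ}
    (hh : h.degree < (n + 1 : ℕ)) :
    (pearsonOp c₂ c₃ (C a₀ * X ^ 2 + C a₁ * X + C a₂) (C b₀ * X + C b₁) h).coeff (n + 1) =
      ((n : K) * a₀ + b₀) * h.coeff n := by
  have hS : ((C b₀ * X + C b₁) * meanLin c₂ c₃ h).coeff (n + 1) = b₀ * h.coeff n := by
    rw [add_mul, coeff_add, mul_assoc, coeff_C_mul, coeff_X_mul, coeff_C_mul,
      coeff_meanLin c₂ c₃ hh, coeff_eq_zero_of_degree_lt (meanLin_mem_degreeLT c₂ c₃ hh)]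
    simp
  have hD := divDiffLin_mem_degreeLT c₂ c₃ hh
  rw [pearsonOp_apply, coeff_add, hS]
  cases n with
  | zero =>
    rw [show divDiffLin c₂ c₃ h = 0 by simpa [degree_eq_bot] using hD]
    simp
  | succ k =>
    have e : (C a₀ * X ^ 2 + C a₁ * X + C a₂) * divDiffLin c₂ c₃ h =
        C a₀ * (X * (X * divDiffLin c₂ c₃ h)) + C a₁ * (X * divDiffLin c₂ c₃ h) +
          C a₂ * divDiffLin c₂ c₃ h := by ring
    rw [degree_lt_iff_coeff_zero] at hD
    rw [e]
    simp only [coeff_add, coeff_C_mul, coeff_X_mul]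
    rw [hD _ le_rfl, hD _ (Nat.le_succ _), coeff_divDiffLin c₂ c₃ hh]
    push_cast; ring

/-- `L` is triangular for the degree with diagonal `λ_n`, so a monic eigenvector of degree `n` can
only have eigenvalue `λ_n`. -/
theorem coeff_latticeOp (c₂ c₃ a₀ a₁ a₂ b₀ b₁ : K) {p : K[X]} {n : ℕ}
    (hp : p.degree < (n + 1 : ℕ)) :
    (latticeOp c₂ c₃ (C a₀ * X ^ 2 + C a₁ * X + C a₂) (C b₀ * X + C b₁) p).coeff n =
      eigenval a₀ b₀ n * p.coeff n := by
  cases n with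
  | zero =>
    have h0 : divDiffLin c₂ c₃ p = 0 := by
      simpa [degree_eq_bot] using divDiffLin_mem_degreeLT c₂ c₃ hp
    simp [latticeOp, h0, eigenval]
  | succ n =>
    rw [latticeOp, LinearMap.comp_apply, coeff_pearsonOp c₂ c₃ a₀ a₁ a₂ b₀ b₁
      (divDiffLin_mem_degreeLT c₂ c₃ hp), coeff_divDiffLin c₂ c₃ hp, eigenval]
    push_cast; ring

section Eigen

variable {c₂ c₃ a₀ a₁ a₂ b₀ b₁ : K} {P : ℕ → K[X]} (hP : IsMonicSeq P)
  (hab : ∀ k : ℕ, (k : K) * a₀ + b₀ ≠ 0)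
  (hL : ∀ n, latticeOp c₂ c₃ (C a₀ * X ^ 2 + C a₁ * X + C a₂) (C b₀ * X + C b₁) (P n) =
    eigenval a₀ b₀ n • P n)

include hP hab hL

/-- In the `k`-th coordinate of the relation applied to `P_n`, all terms without `x` drop out. The
factor left is `(λ_n - λ_k)² - 2a₀(λ_n + λ_k) - b₀² + 2a₀b₀`, which with `d = n - k`, `s = n + k -
1` equals `(d² - 1)((s-1)a₀ + b₀)((s+1)a₀ + b₀)`, nonzero for `d ≥ 2`. -/
theorem repr_X_mul_eq_zero {n k : ℕ} (h : k + 2 ≤ n) : hP.basis.repr (X * P n) k = 0 := by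
  have hrel := latticeOp_relation c₂ c₃ a₀ a₁ a₂ b₀ b₁ _ rfl (P n)
  set L := latticeOp c₂ c₃ (C a₀ * X ^ 2 + C a₁ * X + C a₂) (C b₀ * X + C b₁)
  have hnk : n ≠ k := by omega
  simp only [hL, map_smul, mul_smul_comm, two_mul, ← smul_eq_C_mul] at hrel
  have h' := congrArg (fun p => hP.basis.repr p k) hrel
  simp only [map_add, map_sub, map_smul, Finsupp.add_apply, Finsupp.sub_apply, Finsupp.smul_apply,
    hP.repr_eigen hL, hP.repr_self, if_neg hnk, smul_eq_mul] at h'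
  obtain ⟨j, rfl⟩ := Nat.exists_eq_add_of_le h
  have h1 := hab (2 * k + j)
  have h2 := hab (2 * k + j + 2)
  have h3 : ((j : K) + 1) * (j + 3) ≠ 0 := by
    exact_mod_cast (by positivity : (j + 1) * (j + 3) ≠ 0)
  refine (mul_eq_zero.1 ?_).resolve_left (mul_ne_zero h3 (mul_ne_zero h1 h2))
  simp only [eigenval] at h'
  push_cast at h' ⊢
  linear_combination h'

theorem exists_threeTermRecurrence : ∃ β γ : ℕ → K, ThreeTermRecurrence P β γ := by
  -- By truncated subtraction `γ 0` is a junk value; the recurrence never reads it.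
  refine ⟨fun n => hP.basis.repr (X * P n) n, fun n => hP.basis.repr (X * P n) (n - 1), ?_,
    fun n => ?_⟩
  · refine hP.basis.ext_elem fun k => ?_
    have e : (X : K[X]) - C (hP.basis.repr (X * P 0) 0) =
        X * P 0 - hP.basis.repr (X * P 0) 0 • P 0 := by
      rw [hP.apply_zero, smul_eq_C_mul]; simp
    rw [e, map_sub, map_smul, Finsupp.sub_apply, Finsupp.smul_apply, hP.repr_self, hP.repr_self]
    match k with
    | 0 => simp
    | 1 => simp [hP.repr_X_mul 0]
    | k + 2 => simp [hP.repr_eq_zero (hP.degree_X_mul_lt 0) (by omega : 0 + 2 ≤ k + 2)]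
  · refine hP.basis.ext_elem fun k => ?_
    simp only [← smul_eq_C_mul, map_add, map_smul, Finsupp.add_apply, Finsupp.smul_apply,
      hP.repr_self, Nat.add_sub_cancel, smul_eq_mul]
    rcases lt_or_ge k n with h | h
    · rw [repr_X_mul_eq_zero hP hab hL (by omega : k + 2 ≤ n + 1), if_neg (by omega),
        if_neg (by omega), if_neg (by omega)]
      simp
    obtain ⟨j, rfl⟩ := Nat.exists_eq_add_of_le h
    match j with
    | 0 => simp
    | 1 => simp
    | 2 => simp [hP.repr_X_mul (n + 1)]
    | j + 3 =>
      rw [hP.repr_eq_zero (hP.degree_X_mul_lt (n + 1)) (by omega), if_neg (by omega),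
        if_neg (by omega), if_neg (by omega)]
      simp

/-- The functional of the first coordinate in the eigenbasis makes it orthogonal. -/
theorem coord_zero_mul_eq_zero {m n : ℕ} (h : m ≠ n) : hP.basis.coord 0 (P m * P n) = 0 := by
  have hsub := (eigenval_injective_iff a₀ b₀).2 hab n m h.symm
  have hT : ∀ p, hP.basis.coord 0 (pearsonOp c₂ c₃ (C a₀ * X ^ 2 + C a₁ * X + C a₂)
      (C b₀ * X + C b₁) p) = 0 := fun p => by
    obtain ⟨q, rfl⟩ := divDiffLin_surjective c₂ c₃ p
    have := hP.repr_eigen hL q 0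
    rwa [show eigenval a₀ b₀ 0 = 0 by simp [eigenval], zero_mul] at this
  have hs := congrArg (hP.basis.coord 0) (mul_latticeOp_sub c₂ c₃
    (C a₀ * X ^ 2 + C a₁ * X + C a₂) (C b₀ * X + C b₁) (P n) (P m))
  rw [hT, hL, hL, mul_smul_comm, mul_smul_comm, mul_comm (P n), ← sub_smul, map_smul,
    smul_eq_mul] at hs
  exact (mul_eq_zero.1 hs).resolve_left (sub_ne_zero.2 hsub)

/-- With `Q_n` the divided differences, applying `u` to the Leibniz rule, where `u ∘ L = 0`, turns
`u(Γ(Q_m Q_n))` into a multiple of `u(P_{m+1} P_{n+1})`. For `m = n` the multiplier is nonzero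
because `λ_{n+1} = (n+1)(n a₀ + b₀)` is. -/
theorem isClassicalOPS_of_ne_zero {β γ : ℕ → K} (hr : ThreeTermRecurrence P β γ)
    (hγ : ∀ n, 1 ≤ n → γ n ≠ 0) : IsClassicalOPS c₂ c₃ P := by
  set u := hP.basis.coord 0 with hu
  have horth : ∀ m n, m ≠ n → u (P m * P n) = 0 := fun m n h =>
    coord_zero_mul_eq_zero hP hab hL h
  have hne : ∀ n, u (P n * P n) ≠ 0 := fun n => by
    induction n with
    | zero =>
      rw [hP.apply_zero, one_mul, ← hP.apply_zero, hu, Module.Basis.coord_apply, hP.repr_self]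
      simp
    | succ n ih =>
      rw [hr.map_mul_self hP horth]
      exact mul_ne_zero (hγ _ (by omega)) ih
  refine ⟨⟨hP, u, horth, hne⟩, isMonicSeq_derivedSeq c₂ c₃ hP,
    u ∘ₗ gammaOp c₂ c₃ (C a₀ * X ^ 2 + C a₁ * X + C a₂) (C b₀ * X + C b₁), ?_⟩
  have key : ∀ m n : ℕ, ((m : K) + 1) * ((n : K) + 1) *
      u (gammaOp c₂ c₃ (C a₀ * X ^ 2 + C a₁ * X + C a₂) (C b₀ * X + C b₁)
        (derivedSeq c₂ c₃ P m * derivedSeq c₂ c₃ P n)) =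
      -(eigenval a₀ b₀ (m + 1) + eigenval a₀ b₀ (n + 1)) * u (P (m + 1) * P (n + 1)) := by
    intro m n
    have h := congrArg u (latticeOp_mul c₂ c₃ (C a₀ * X ^ 2 + C a₁ * X + C a₂)
      (C b₀ * X + C b₁) (P (m + 1)) (P (n + 1)))
    have h0 := hP.repr_eigen hL (P (m + 1) * P (n + 1)) 0
    rw [show eigenval a₀ b₀ 0 = 0 by simp [eigenval], zero_mul] at h0
    rw [hu, Module.Basis.coord_apply, h0, ← hu, hL, hL, divDiffLin_eq_derivedSeq,
      divDiffLin_eq_derivedSeq, smul_mul_smul_comm, mul_smul_comm, mul_smul_comm,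
      mul_comm (P (n + 1)), map_add, map_add, map_smul, map_smul, map_smul, map_smul] at h
    simp only [smul_eq_mul] at h
    linear_combination -h
  have hn : ∀ n : ℕ, ((n : K) + 1) ≠ 0 := fun n => by exact_mod_cast n.succ_ne_zero
  refine ⟨fun m n hmn => ?_, fun n => ?_⟩
  · have := key m n
    rw [horth _ _ (by omega : m + 1 ≠ n + 1), mul_zero] at this
    exact (mul_eq_zero.1 this).resolve_left (mul_ne_zero (hn m) (hn n))
  · intro h0
    have := key n n
    rw [← LinearMap.comp_apply, h0, mul_zero, eq_comm, mul_eq_zero, neg_eq_zero, ← two_mul,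
      mul_eq_zero] at this
    rcases this with (h | h) | h
    · exact two_ne_zero h
    · rw [eigenval] at h
      push_cast at h
      rw [add_sub_cancel_right] at h
      exact mul_ne_zero (hn n) (hab n) h
    · exact hne _ h

end Eigen

/-- A classical OPS consists of eigenvectors of an operator `φ 𝔻² + ψ 𝕊 𝔻`. -/
theorem IsClassicalOPS.exists_eigen {c₂ c₃ : K} {P : ℕ → K[X]} (h : IsClassicalOPS c₂ c₃ P) :
    ∃ a₀ a₁ a₂ b₀ b₁ : K, (∀ k : ℕ, (k : K) * a₀ + b₀ ≠ 0) ∧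
      ∀ n, latticeOp c₂ c₃ (C a₀ * X ^ 2 + C a₁ * X + C a₂) (C b₀ * X + C b₁) (P n) =
        eigenval a₀ b₀ n • P n := by
  obtain ⟨⟨hP, u, hu, hu'⟩, hQ, v, hv, hv'⟩ := h
  have hn : ∀ n : ℕ, ((n : K) + 1) ≠ 0 := fun n => by exact_mod_cast n.succ_ne_zero
  have hP0 : divDiffLin c₂ c₃ (P 0) = 0 := by rw [hP.apply_zero, divDiffLin_one]
  have hQ0 : ∀ n, 1 ≤ n → v (derivedSeq c₂ c₃ P n) = 0 := fun n hn => by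
    have := hv 0 n (by omega)
    rwa [hQ.apply_zero, one_mul] at this
  have hvD : ∀ n, 2 ≤ n → (v ∘ₗ divDiffLin c₂ c₃) (P n) = 0 := fun n hn => by
    obtain ⟨k, rfl⟩ := Nat.exists_eq_add_of_le' (show 1 ≤ n by omega)
    rw [LinearMap.comp_apply, divDiffLin_eq_derivedSeq, map_smul, hQ0 k (by omega), smul_zero]
  obtain ⟨ψ, hψd, hψ⟩ := hP.exists_functional_eq hu hu' (v ∘ₗ divDiffLin c₂ c₃) 2 hvD
  have hvS : ∀ n, 3 ≤ n → (v ∘ₗ meanLin c₂ c₃) (P n) = 0 := fun n hn => by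
    obtain ⟨k, rfl⟩ := Nat.exists_eq_add_of_le' (show 1 ≤ n by omega)
    -- The rule `𝔻(x f) = 𝕊 f + (x + 1/4) 𝔻 f` expresses `v ∘ 𝕊` through `v ∘ 𝔻`, at the cost of one
    -- degree.
    have e : meanLin c₂ c₃ (P (k + 1)) = divDiffLin c₂ c₃ (X * P (k + 1)) -
        ((k : K) + 1) • ((X + C (1 / 4)) * derivedSeq c₂ c₃ P k) := by
      rw [← mul_smul_comm, ← divDiffLin_eq_derivedSeq, divDiffLin_mul, divDiffLin_X, meanLin_X]
      ring
    have h1 : v (divDiffLin c₂ c₃ (X * P (k + 1))) = 0 := by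
      have := hψ (X * P (k + 1))
      rw [LinearMap.comp_apply, ← mul_assoc] at this
      rw [this]
      refine hP.map_mul_eq_zero hu (lt_of_lt_of_le ?_ (Nat.cast_le.2 hn))
      rw [degree_mul, degree_X]
      exact WithBot.add_lt_add_right (by simp) hψd
    have h2 : v ((X + C (1 / 4)) * derivedSeq c₂ c₃ P k) = 0 := by
      refine hQ.map_mul_eq_zero hv ?_
      rw [degree_X_add_C]
      exact_mod_cast (by omega : 1 < k)
    rw [LinearMap.comp_apply, e, map_sub, map_smul, h1, h2]; simp
  obtain ⟨χ, hχd, hχ⟩ := hP.exists_functional_eq hu hu' (v ∘ₗ meanLin c₂ c₃) 3 hvS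
  have hψe : C (ψ.coeff 1) * X + C (ψ.coeff 0) = ψ :=
    (eq_X_add_C_of_degree_le_one (Order.le_of_lt_succ hψd)).symm
  -- Forced by the summation by parts below: `f 𝔻g = 𝔻(g 𝕊f) - 𝕊(g 𝔻f) - ½ 𝔻(g 𝔻f)`, where `v ∘ 𝔻`
  -- and `v ∘ 𝕊` are `u` times `ψ` and `χ`.
  set φ : K[X] := -(χ + C (1 / 2) * ψ) with hφ
  have hφd : φ.degree < (3 : ℕ) := by
    rw [← mem_degreeLT] at hψd hχd ⊢
    rw [hφ, ← smul_eq_C_mul]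
    exact Submodule.neg_mem _ (Submodule.add_mem _ hχd
      (Submodule.smul_mem _ _ (degreeLT_mono (by norm_num) hψd)))
  have hφe : C (φ.coeff 2) * X ^ 2 + C (φ.coeff 1) * X + C (φ.coeff 0) = φ := by
    rw [degree_lt_iff_coeff_zero] at hφd
    ext i
    match i with
    | 0 => simp
    | 1 => simp [coeff_C]
    | 2 => simp
    | i + 3 => rw [hφd (i + 3) (by omega)]; simp
  have hT : ∀ f g, u (g * pearsonOp c₂ c₃ φ ψ f) = v (f * divDiffLin c₂ c₃ g) := fun f g => by
    have e : f * divDiffLin c₂ c₃ g = divDiffLin c₂ c₃ (g * meanLin c₂ c₃ f) -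
        meanLin c₂ c₃ (g * divDiffLin c₂ c₃ f) -
        C (1 / 2) * divDiffLin c₂ c₃ (g * divDiffLin c₂ c₃ f) := by
      simp only [divDiffLin_mul, meanLin_mul, divDiffLin_meanLin, meanLin_meanLin]
      refine Polynomial.funext fun x => ?_
      simp only [eval_add, eval_sub, eval_mul, eval_X, eval_C]
      ring
    have h1 := hψ (g * meanLin c₂ c₃ f)
    have h2 := hχ (g * divDiffLin c₂ c₃ f)
    have h3 := hψ (g * divDiffLin c₂ c₃ f)
    rw [LinearMap.comp_apply] at h1 h2 h3
    rw [e, map_sub, map_sub, ← smul_eq_C_mul, map_smul, h1, h2, h3, ← map_smul, ← map_sub,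
      ← map_sub, pearsonOp_apply, hφ, smul_eq_C_mul]
    congr 1
    ring
  have horth : ∀ m n, m ≠ n → u (P m * latticeOp c₂ c₃ φ ψ (P n)) = 0 := fun m n hmn => by
    rw [latticeOp, LinearMap.comp_apply, hT]
    cases m with
    | zero => rw [hP0, mul_zero, map_zero]
    | succ m =>
      cases n with
      | zero => rw [hP0, zero_mul, map_zero]
      | succ n =>
        rw [divDiffLin_eq_derivedSeq, divDiffLin_eq_derivedSeq, smul_mul_smul_comm, map_smul,
          hv n m (by omega), smul_zero]
  have hrepr : ∀ m n, m ≠ n → hP.basis.repr (latticeOp c₂ c₃ φ ψ (P n)) m = 0 :=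
    fun m n hmn => by
      have := hP.map_mul_eq_repr hu (latticeOp c₂ c₃ φ ψ (P n)) m
      rw [mul_comm, horth m n hmn, eq_comm] at this
      exact (mul_eq_zero.1 this).resolve_right (hu' m)
  have heig : ∀ n, latticeOp c₂ c₃ φ ψ (P n) =
      hP.basis.repr (latticeOp c₂ c₃ φ ψ (P n)) n • P n := fun n => by
    refine hP.basis.ext_elem fun k => ?_
    rw [map_smul, Finsupp.smul_apply, hP.repr_self]
    by_cases h : n = k
    · subst h; simp
    · simp [h, hrepr k n (Ne.symm h)]
  have hval : ∀ n, hP.basis.repr (latticeOp c₂ c₃ φ ψ (P n)) n =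
      eigenval (φ.coeff 2) (ψ.coeff 1) n := fun n => by
    have h1 := coeff_latticeOp c₂ c₃ (φ.coeff 2) (φ.coeff 1) (φ.coeff 0) (ψ.coeff 1) (ψ.coeff 0)
      (hP.degree_lt_succ n)
    rw [hφe, hψe, heig n, coeff_smul, hP.coeff_self, smul_eq_mul, mul_one, mul_one] at h1
    exact h1
  refine ⟨φ.coeff 2, φ.coeff 1, φ.coeff 0, ψ.coeff 1, ψ.coeff 0, fun k hk => ?_, fun n => ?_⟩
  · have h0 : latticeOp c₂ c₃ φ ψ (P (k + 1)) = 0 := by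
      rw [heig, hval, eigenval]
      push_cast
      rw [add_sub_cancel_right, hk, mul_zero, zero_smul]
    have h1 := hT (divDiffLin c₂ c₃ (P (k + 1))) (P (k + 1))
    rw [← LinearMap.comp_apply, ← latticeOp, h0, mul_zero, map_zero, divDiffLin_eq_derivedSeq,
      smul_mul_smul_comm, map_smul, eq_comm, smul_eq_mul] at h1
    exact mul_ne_zero (mul_ne_zero (hn k) (hn k)) (hv' k) h1
  · rw [hφe, hψe, heig, hval]

end QuadLattice

theorem mainTheorem6 {K : Type*} [Field K] [CharZero K] (c₂ c₃ : K)
    (P : ℕ → Polynomial K) (hP : QuadLattice.IsMonicSeq P)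
    (A : Matrix ℕ ℕ K) (hA : QuadLattice.IsCoeffMatrix c₂ c₃ P A) :
    -- the Sylvester equation is the divided-difference equation for all `P_n`
    (∀ a₀ a₁ a₂ b₀ b₁ : K,
      QuadLattice.SylvesterEq c₂ c₃ a₀ a₁ a₂ b₀ b₁ A ↔
        ∀ n, QuadLattice.DividedDifferenceEq c₂ c₃ a₀ a₁ a₂ b₀ b₁
          (QuadLattice.eigenval a₀ b₀ n) (P n)) ∧
    -- a monic OPS is classical iff its matrix solves a Sylvester equation with distinct `λ_n`
    (QuadLattice.IsClassicalOPS c₂ c₃ P ↔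
      QuadLattice.IsOPS P ∧ ∃ a₀ a₁ a₂ b₀ b₁ : K,
        (∀ n m, n ≠ m → QuadLattice.eigenval a₀ b₀ n ≠ QuadLattice.eigenval a₀ b₀ m) ∧
          QuadLattice.SylvesterEq c₂ c₃ a₀ a₁ a₂ b₀ b₁ A) ∧
    -- a solution with distinct `λ_n` satisfies a three-term recurrence relation, and it is a
    -- classical OPS unless this recurrence degenerates
    (∀ a₀ a₁ a₂ b₀ b₁ : K,
      (∀ n m, n ≠ m → QuadLattice.eigenval a₀ b₀ n ≠ QuadLattice.eigenval a₀ b₀ m) →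
        QuadLattice.SylvesterEq c₂ c₃ a₀ a₁ a₂ b₀ b₁ A →
          ∃ β γ : ℕ → K, QuadLattice.ThreeTermRecurrence P β γ ∧
            (QuadLattice.IsClassicalOPS c₂ c₃ P ↔ ∀ n, 1 ≤ n → γ n ≠ 0)) := by
  -- This settles the first claim and restates the others through `L` and `k a₀ + b₀ ≠ 0`.
  simp only [QuadLattice.sylvesterEq_iff hA, QuadLattice.dividedDifferenceEq_iff,
    QuadLattice.eigenval_injective_iff, implies_true, true_and]
  refine ⟨⟨fun h => ⟨h.1, h.exists_eigen⟩, ?_⟩, fun a₀ a₁ a₂ b₀ b₁ hab hL => ?_⟩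
  · rintro ⟨hops, a₀, a₁, a₂, b₀, b₁, hab, hL⟩
    obtain ⟨β, γ, hr⟩ := QuadLattice.exists_threeTermRecurrence hP hab hL
    exact QuadLattice.isClassicalOPS_of_ne_zero hP hab hL hr (hr.ne_zero_of_isOPS hops)
  · obtain ⟨β, γ, hr⟩ := QuadLattice.exists_threeTermRecurrence hP hab hL
    exact ⟨β, γ, hr, fun h => hr.ne_zero_of_isOPS h.1,
      QuadLattice.isClassicalOPS_of_ne_zero hP hab hL hr⟩
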